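/- Let $n\ge 0$, let $\mathbf a=(a_1,\dots,a_n)$ be a sequence of nonnegative integers, and put $a=a_1+\cdots+a_n$. Let $q$ be an indeterminate and, for an integer $p\ge 0$, put $$(z)_p=(1-z)(1-zq)\cdots(1-zq^{p-1}),\qquad (z)_{-p}=\frac{1}{(1-zq^{-1})(1-zq^{-2})\cdots(1-zq^{-p})}.$$ For every integer $b$ define $$Q_{\mathbf a}(q^b)=\mathop{\mathrm{CT}}_{x_0,x_1,\dots,x_n}\ \prod_{j=1}^n\left(\frac{x_0}{x_j}\right)_{b}\left(\frac{x_j}{x_0}q\right)_{a_j}\ \prod_{1\le i<j\le n}\left(\frac{x_i}{x_j}\right)_{a_i}\left(\frac{x_j}{x_i}q\right)_{a_j}\in\mathbb C(q),$$ where the product is regarded as a formal Laurent series in $x_0$ whose coefficients are Laurent polynomials in $x_1,\dots,x_n$ over $\mathbb C(q)$, and $\mathrm{CT}_{x_0,\dots,x_n}$ denotes the coefficient of $x_0^0x_1^0\cdots x_n^0$. Then $$Q_{\mathbf a}(q^b)=0\qquad\text{for } b=-1,-2,\dots,-a.$$ -/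

import Mathlib

open Finset

noncomputable section

namespace QDyson

/-- The base field `ℂ(q)` of rational functions in one indeterminate `q`. -/
abbrev K : Type := RatFunc ℂ

/-- The indeterminate `q`, as an element of `ℂ(q)`. -/
def q : K := RatFunc.X

/-- The ring `ℂ(q)[x₁^{±1}, …, xₙ^{±1}]` of Laurent polynomials, as the group algebra of `ℤⁿ`. -/
abbrev LaurentPoly (n : ℕ) : Type := AddMonoidAlgebra K (Fin n → ℤ)

/-- The ring of formal Laurent series in `x₀` whose coefficients are Laurent polynomials
in `x₁, …, xₙ` over `ℂ(q)`. -/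
abbrev Series (n : ℕ) : Type := LaurentSeries (LaurentPoly n)

/-- The Laurent monomial `x₀^{e₀} x₁^{e₁} ⋯ xₙ^{eₙ}`. -/
def monomial {n : ℕ} (e : Fin (n + 1) → ℤ) : Series n :=
  HahnSeries.single (e 0) (AddMonoidAlgebra.single (fun j : Fin n => e j.succ) (1 : K))

/-- The Laurent monomial `xᵢ / xⱼ`, for `0 ≤ i, j ≤ n`. -/
def ratio {n : ℕ} (i j : Fin (n + 1)) : Series n :=
  monomial (Pi.single i 1 - Pi.single j 1)

/-- The `q`-shifted factorial `(z)_k` for an arbitrary integer `k`: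
`(z)_p = (1 - z)(1 - z q) ⋯ (1 - z q^{p-1})` and
`(z)_{-p} = 1 / ((1 - z q⁻¹)(1 - z q⁻²) ⋯ (1 - z q^{-p}))` for `p ≥ 0`.
The inverse is the inverse of a unit of the ring of Laurent series in every case in which it is
used below, see `isUnit_denominator`. -/
def qFac {n : ℕ} (z : Series n) : ℤ → Series n
  | Int.ofNat p => ∏ m ∈ range p, (1 - q ^ m • z)
  | Int.negSucc p => Ring.inverse (∏ m ∈ range (p + 1), (1 - (q⁻¹) ^ (m + 1) • z))

/-- The constant term in `x₀, x₁, …, xₙ`: first the coefficient of `x₀⁰`, which is a Laurent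
polynomial in `x₁, …, xₙ`, and then the coefficient of `x₁⁰ ⋯ xₙ⁰` in it. -/
def constTerm {n : ℕ} (f : Series n) : K := (f.coeff 0).coeff 0

/-- The `q`-Dyson product with exponent `b ∈ ℤ` for `x₀` and `a₁, …, aₙ` for `x₁, …, xₙ`
(`a j` belongs to the variable with index `j.succ`), as a Laurent series in `x₀`. -/
def dysonProd {n : ℕ} (a : Fin n → ℕ) (b : ℤ) : Series n :=
  (∏ j : Fin n, qFac (ratio 0 j.succ) b * qFac (q • ratio j.succ 0) (a j)) *
    ∏ i : Fin n, ∏ j ∈ Ioi i,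
      qFac (ratio i.succ j.succ) (a i) * qFac (q • ratio j.succ i.succ) (a j)

/-- The constant term `Q_a(q^b)` of the `q`-Dyson product, for an arbitrary integer `b`. -/
def Q {n : ℕ} (a : Fin n → ℕ) (b : ℤ) : K := constTerm (dysonProd a b)

/-- The denominators that occur in the `q`-Dyson product for negative `b` are invertible in the
ring of Laurent series in `x₀`. -/
theorem isUnit_denominator {n : ℕ} (j : Fin n) (p : ℕ) :
    IsUnit (∏ m ∈ range p, (1 - (q⁻¹) ^ (m + 1) • (ratio 0 j.succ : Series n))) := by
  refine Finset.prod_induction _ IsUnit (fun _ _ h h' => h.mul h') isUnit_one fun m _ =>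
    HahnSeries.isUnit_of_orderTop_pos ?_
  have h : (1 - (q⁻¹) ^ (m + 1) • (ratio 0 j.succ : Series n)) - 1 =
      HahnSeries.single (1 : ℤ) (-((q⁻¹) ^ (m + 1) • AddMonoidAlgebra.single
        (fun k : Fin n => (Pi.single 0 1 - Pi.single j.succ 1 : Fin (n + 1) → ℤ) k.succ)
        (1 : K))) := by
    have h0 : (Pi.single 0 1 - Pi.single j.succ 1 : Fin (n + 1) → ℤ) 0 = 1 := by simp
    rw [sub_sub_cancel_left, ratio, monomial, h0]
    refine HahnSeries.ext (funext fun k => ?_)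
    by_cases hk : k = 1
    · subst hk
      simp
    · simp [HahnSeries.coeff_single_of_ne hk]
  rw [h]
  exact HahnSeries.lt_orderTop_single Int.zero_lt_one

end QDyson

end

namespace QDyson

/-! The constant term is a polynomial in `z = q ^ b`, uniformly over all integers `b`
(`exists_polynomial_eval_eq_Q`), so it is determined by its values at natural `b`.

For natural `b` it is a coefficient of a polynomial whose degree is at most that of the monomial
extracted. Interpolation on a grid of powers of `q` (`coeff_eq_sum_piFinset`) writes it as a sum
over grid points, of which a single one survives (`eq_sum_Iio_of_eval_dysonPoly_ne_zero`). The
resulting product formula gives a polynomial identity `P * den = vanishingNum * restNum`, valid at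
infinitely many `z`. At `z = q ^ (-1), …, q ^ (-a)` the factor `vanishingNum` is zero and `den` is
not. -/

/-! ### Coefficient extraction by interpolation on a grid -/

/-- Quantitative Combinatorial Nullstellensatz. On each monomial of `f` the grid sum factors into
univariate Lagrange formulas for a leading coefficient. -/
theorem coeff_eq_sum_piFinset {k σ : Type*} [Field k] [Fintype σ] [DecidableEq σ]
    {f : MvPolynomial σ k} {d : σ →₀ ℕ} (hf : f.totalDegree ≤ ∑ i, d i) {v : ℕ → k}
    (hv : Function.Injective v) :
    f.coeff d = ∑ c ∈ Fintype.piFinset fun i => range (d i + 1),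
      MvPolynomial.eval (fun i => v (c i)) f *
        ∏ i, (∏ t ∈ (range (d i + 1)).erase (c i), (v (c i) - v t))⁻¹ := by
  have key : ∀ e ∈ f.support, ∏ i, ∑ c ∈ range (d i + 1),
      v c ^ e i * (∏ t ∈ (range (d i + 1)).erase c, (v c - v t))⁻¹ = if e = d then 1 else 0 := by
    intro e he
    have hone : ∀ i, e i ≤ d i → ∑ c ∈ range (d i + 1),
        v c ^ e i * (∏ t ∈ (range (d i + 1)).erase c, (v c - v t))⁻¹ =
          if e i = d i then 1 else 0 := by
      intro i hi
      have := Lagrange.coeff_eq_sum (s := range (d i + 1)) (v := v) hv.injOn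
        (P := Polynomial.X ^ e i) (by
          rw [Polynomial.degree_X_pow, card_range]; exact_mod_cast Nat.lt_succ_of_le hi)
      simp only [card_range, Nat.add_sub_cancel, Polynomial.coeff_X_pow, Polynomial.eval_pow,
        Polynomial.eval_X, div_eq_mul_inv] at this
      rw [← this]
      simp only [eq_comm]
    split_ifs with h
    · subst h
      exact prod_eq_one fun i _ => by rw [hone i le_rfl, if_pos rfl]
    · have hle : ∑ i, e i ≤ ∑ i, d i := by
        refine le_trans ?_ hf
        have := MvPolynomial.le_totalDegree he
        rwa [Finsupp.sum_fintype _ _ fun _ => rfl] at this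
      -- One deficient exponent kills the whole product, so exponents exceeding `d` elsewhere do no
      -- harm.
      obtain ⟨i, hi⟩ : ∃ i, e i < d i := by
        by_contra! hcon
        refine h (Finsupp.ext fun i => ?_)
        exact ((sum_eq_sum_iff_of_le fun i _ => hcon i).1
          (le_antisymm (sum_le_sum fun i _ => hcon i) hle) i (mem_univ i)).symm
      exact prod_eq_zero (mem_univ i) (by rw [hone i hi.le, if_neg hi.ne])
  calc f.coeff d = ∑ e ∈ f.support, f.coeff e * if e = d then 1 else 0 := by
        simp [eq_comm]
    _ = _ := by
        rw [sum_congr rfl fun e he => by rw [← key e he]]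
        simp only [MvPolynomial.eval_eq', prod_univ_sum, sum_mul, mul_sum]
        rw [sum_comm]
        refine sum_congr rfl fun c _ => sum_congr rfl fun e _ => ?_
        rw [prod_mul_distrib, mul_assoc]

/-! ### Packing intervals and partial sums -/

theorem sum_Iio_zero {M : Type*} [AddCommMonoid M] {m : ℕ} (f : Fin (m + 1) → M) : ∑ k ∈ Iio (0 : Fin (m + 1)), f k = 0 := by
  have : Iio (0 : Fin (m + 1)) = ∅ := by
    ext j
    simp
  rw [this, sum_empty]

theorem sum_Iio_succ {M : Type*} [AddCommMonoid M] {m : ℕ} (f : Fin (m + 1) → M) (i : Fin m) :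
    ∑ j ∈ Iio i.succ, f j = ∑ j ∈ Iio i.castSucc, f j + f i.castSucc := by
  have : Iio i.succ = insert i.castSucc (Iio i.castSucc) := by
    ext j
    simp only [mem_Iio, mem_insert, Fin.lt_def, Fin.ext_iff, Fin.val_succ, Fin.val_castSucc]
    omega
  rw [this, sum_insert (by simp), add_comm]

theorem sum_Iio_last_add {M : Type*} [AddCommMonoid M] {m : ℕ} (f : Fin (m + 1) → M) :
    ∑ j ∈ Iio (Fin.last m), f j + f (Fin.last m) = ∑ j, f j := by
  have : (univ : Finset (Fin (m + 1))) = insert (Fin.last m) (Iio (Fin.last m)) := by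
    ext j
    simp only [mem_univ, mem_Iio, mem_insert, Fin.lt_def, Fin.ext_iff, Fin.val_last, true_iff]
    have := j.is_lt
    omega
  rw [this, sum_insert (by simp), add_comm]

/-- Intervals `[α i, α i + a i)` that are pairwise disjoint, with a gap at every inversion of the
indices, and that all fit into `[0, ∑ a)` lie in the order of their indices without gaps. -/
theorem eq_sum_Iio_of_separated {m : ℕ} {a α : Fin (m + 1) → ℕ}
    (hle : ∀ i, α i + a i ≤ ∑ j, a j)
    (h₁ : ∀ i j, i < j → α i ≤ α j → α i + a i ≤ α j)
    (h₂ : ∀ i j, i < j → α j < α i → α j + a j < α i) (i : Fin (m + 1)) :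
    α i = ∑ j ∈ Iio i, a j := by
  -- Empty intervals may share a left endpoint; ties are broken by index, so that a descent of `τ`
  -- forces strictly increasing endpoints.
  set g : Fin (m + 1) → ℕ ×ₗ Fin (m + 1) := fun i => toLex (α i, i) with hg
  set τ := Tuple.sort g with hτ
  have hinj : Function.Injective g := fun i j h => by
    have := congrArg (fun x => (ofLex x).2) h
    simpa [hg] using this
  have hmono : StrictMono (g ∘ τ) :=
    (Tuple.monotone_sort g).strictMono_of_injective (hinj.comp τ.injective)
  -- The uncovered length to the left of the `k`-th interval: nondecreasing, strictly so at a
  -- descent of `τ`, and squeezed to zero by the total room.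
  set h : Fin (m + 1) → ℤ := fun k => (α (τ k) : ℤ) - ((∑ l ∈ Iio k, a (τ l) : ℕ) : ℤ) with hh
  have hstep : ∀ k : Fin m, h k.castSucc ≤ h k.succ ∧
      (τ k.succ < τ k.castSucc → h k.castSucc < h k.succ) := by
    intro k
    have hlt := hmono (Fin.castSucc_lt_succ (i := k))
    simp only [hg, Function.comp, Prod.Lex.toLex_lt_toLex] at hlt
    have hs := sum_Iio_succ (fun l => a (τ l)) k
    rcases lt_trichotomy (τ k.castSucc) (τ k.succ) with hc | hc | hc
    · have := h₁ _ _ hc (by omega)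
      simp only [hh]
      omega
    · exact absurd (τ.injective hc) (Fin.castSucc_lt_succ).ne
    · have hlt' : α (τ k.castSucc) < α (τ k.succ) := by
        rcases hlt with hlt | ⟨_, hlt⟩
        · exact hlt
        · exact absurd hlt hc.not_gt
      have := h₂ _ _ hc hlt'
      simp only [hh]
      omega
  have hm : Monotone h := Fin.monotone_iff_le_succ.2 fun k => (hstep k).1
  have h0 : 0 ≤ h 0 := by
    simp only [hh, sum_Iio_zero]
    simp
  have hlast : h (Fin.last m) ≤ 0 := by
    have h3 := hle (τ (Fin.last m))
    have h4 := sum_Iio_last_add fun l => a (τ l)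
    rw [Equiv.sum_comp τ a] at h4
    simp only [hh]
    omega
  have hzero : ∀ k, h k = 0 := fun k =>
    le_antisymm ((hm (Fin.le_last k)).trans hlast) (h0.trans (hm (Fin.zero_le k)))
  have hτmono : Monotone τ := Fin.monotone_iff_le_succ.2 fun k => by
    by_contra! hcon
    have := (hstep k).2 hcon
    rw [hzero, hzero] at this
    exact lt_irrefl _ this
  have hτone : τ = 1 := (Equiv.Perm.monotone_iff τ).1 hτmono
  have := hzero i
  simp only [hh, hτone, Equiv.Perm.coe_one, id] at this
  omega

theorem sum_Iio_add_le {m : ℕ} (a : Fin m → ℕ) (i : Fin m) :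
    ∑ j ∈ Iio i, a j + a i ≤ ∑ j, a j := by
  rw [add_comm, ← sum_insert (by simp)]
  exact sum_le_sum_of_subset (subset_univ _)

theorem exists_eq_sum_Iio_add {n : ℕ} (a : Fin n → ℕ) {m : ℕ} (hm : m < ∑ j, a j) :
    ∃ j, ∃ t < a j, m = ∑ i ∈ Iio j, a i + t := by
  induction n with
  | zero => simp at hm
  | succ n ih =>
    rw [Fin.sum_univ_castSucc] at hm
    by_cases h : m < ∑ j : Fin n, a j.castSucc
    · obtain ⟨j, t, ht, rfl⟩ := ih (fun j => a j.castSucc) h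
      refine ⟨j.castSucc, t, ht, ?_⟩
      rw [Fin.Iio_castSucc, sum_map]
      rfl
    · refine ⟨Fin.last n, m - ∑ j : Fin n, a j.castSucc, by omega, ?_⟩
      have h1 := sum_Iio_last_add a
      rw [Fin.sum_univ_castSucc] at h1
      omega

variable {n : ℕ}

/-! ### Laurent monomials, constant terms and polynomials -/

theorem q_ne_zero : q ≠ 0 := RatFunc.X_ne_zero

theorem q_pow_injective : Function.Injective fun t : ℕ => q ^ t := by
  have h : ∀ t : ℕ, q ^ t = algebraMap (Polynomial ℂ) K (Polynomial.X ^ t) := fun t => by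
    rw [map_pow, RatFunc.algebraMap_X, q]
  intro s t hst
  simp only [h] at hst
  simpa using congrArg Polynomial.natDegree (RatFunc.algebraMap_injective ℂ hst)


theorem monomial_zero : monomial (0 : Fin (n + 1) → ℤ) = 1 := rfl

theorem monomial_add (e f : Fin (n + 1) → ℤ) : monomial (e + f) = monomial e * monomial f := by
  rw [monomial, monomial, monomial, HahnSeries.single_mul_single,
    AddMonoidAlgebra.single_mul_single, one_mul]
  rfl

theorem monomial_sum {ι : Type*} (s : Finset ι) (e : ι → Fin (n + 1) → ℤ) :
    monomial (∑ i ∈ s, e i) = ∏ i ∈ s, monomial (e i) := by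
  classical
  induction s using Finset.induction_on with
  | empty => simp [monomial_zero]
  | insert i s hi ih => rw [sum_insert hi, prod_insert hi, monomial_add, ih]

theorem monomial_nsmul (p : ℕ) (e : Fin (n + 1) → ℤ) :
    monomial (p • e) = monomial e ^ p := by
  induction p with
  | zero => simp [monomial_zero]
  | succ p ih => rw [succ_nsmul, monomial_add, ih, pow_succ]

theorem constTerm_add (f g : Series n) : constTerm (f + g) = constTerm f + constTerm g := by
  simp [constTerm]

theorem constTerm_smul_monomial (c : K) (e : Fin (n + 1) → ℤ) :
    constTerm (c • monomial e) = if e = 0 then c else 0 := by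
  have he : e = 0 ↔ e 0 = 0 ∧ (fun j : Fin n => e j.succ) = 0 := by
    constructor
    · rintro rfl
      exact ⟨rfl, rfl⟩
    · rintro ⟨h₀, h⟩
      funext i
      refine Fin.cases h₀ (fun j => congrFun h j) i
  rw [constTerm, monomial, HahnSeries.coeff_smul]
  by_cases h₀ : e 0 = 0
  · rw [h₀, HahnSeries.coeff_single_same]
    by_cases h : (fun j : Fin n => e j.succ) = 0
    · rw [if_pos (he.2 ⟨h₀, h⟩), h]
      simp
    · rw [if_neg fun hh => h (he.1 hh).2]
      simp [h]
  · rw [HahnSeries.coeff_single_of_ne (Ne.symm h₀), if_neg fun hh => h₀ (he.1 hh).1]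
    simp

/-- The embedding of the constants into the Laurent series. -/
noncomputable def const : K →+* Series n :=
  HahnSeries.C.comp (algebraMap K (LaurentPoly n))

theorem smul_eq_const_mul (c : K) (f : Series n) : c • f = const c * f := by
  refine HahnSeries.ext (funext fun k => ?_)
  rw [const, RingHom.comp_apply, HahnSeries.C_mul_eq_smul, HahnSeries.coeff_smul,
    HahnSeries.coeff_smul, smul_eq_mul, Algebra.smul_def]

/-- Polynomials in `x₀, …, xₙ` as Laurent series. -/
noncomputable def toSeries : MvPolynomial (Fin (n + 1)) K →+* Series n :=
  MvPolynomial.eval₂Hom const fun i => monomial (Pi.single i 1)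

theorem toSeries_X (i : Fin (n + 1)) :
    toSeries (MvPolynomial.X i) = (monomial (Pi.single i 1) : Series n) :=
  MvPolynomial.eval₂_X _ _ i

theorem toSeries_C (c : K) : toSeries (MvPolynomial.C c) = (const c : Series n) :=
  MvPolynomial.eval₂_C _ _ c

theorem toSeries_monomial (d : Fin (n + 1) →₀ ℕ) (c : K) :
    toSeries (MvPolynomial.monomial d c) = c • (monomial fun i => (d i : ℤ) : Series n) := by
  rw [toSeries, MvPolynomial.coe_eval₂Hom, MvPolynomial.eval₂_monomial,
    Finsupp.prod_fintype _ _ (by simp), smul_eq_const_mul]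
  congr 1
  simp only [← monomial_nsmul, ← monomial_sum]
  congr 1
  funext i
  simp [Finset.sum_apply, Pi.single_apply]

theorem constTerm_monomial_neg_mul_toSeries (d : Fin (n + 1) →₀ ℕ)
    (f : MvPolynomial (Fin (n + 1)) K) :
    constTerm (monomial (-fun i => (d i : ℤ)) * toSeries f) = f.coeff d := by
  induction f using MvPolynomial.induction_on' with
  | monomial e c =>
    rw [toSeries_monomial, smul_eq_const_mul, mul_left_comm, ← monomial_add, ← smul_eq_const_mul,
      constTerm_smul_monomial,
      MvPolynomial.coeff_monomial]
    refine if_congr ?_ rfl rfl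
    rw [neg_add_eq_zero, funext_iff, Finsupp.ext_iff]
    simp only [Nat.cast_inj, eq_comm]
  | add f g hf hg => rw [map_add, mul_add, constTerm_add, hf, hg, MvPolynomial.coeff_add]

theorem ratio_mul_monomial (i j : Fin (n + 1)) :
    ratio i j * monomial (Pi.single j 1) = (monomial (Pi.single i 1) : Series n) := by
  rw [ratio, ← monomial_add, sub_add_cancel]

theorem qFac_smul_ratio_mul_monomial (c : K) (i j : Fin (n + 1)) (p : ℕ) :
    qFac (c • ratio i j) p * monomial (p • Pi.single j 1) = toSeries (n := n)
      (∏ t ∈ range p, (MvPolynomial.X j - MvPolynomial.C (q ^ t * c) * MvPolynomial.X i)) := by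
  rw [monomial_nsmul, map_prod, ← Int.ofNat_eq_natCast, qFac, ← card_range p, ← prod_const,
    card_range, ← prod_mul_distrib]
  refine prod_congr rfl fun t _ => ?_
  rw [map_sub, map_mul, toSeries_C, toSeries_X, toSeries_X, sub_mul, one_mul, smul_eq_const_mul,
    smul_eq_const_mul, ← mul_assoc, ← map_mul, mul_assoc, ratio_mul_monomial]

/-! ### The product formula for natural exponents -/

/-- The homogeneous polynomial obtained from the `q`-Dyson product by clearing denominators. -/
noncomputable def dysonPoly {m : ℕ} (a : Fin m → ℕ) : MvPolynomial (Fin m) K :=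
  ∏ i, ∏ j ∈ Ioi i,
    (∏ t ∈ range (a i), (MvPolynomial.X j - MvPolynomial.C (q ^ t) * MvPolynomial.X i)) *
      ∏ t ∈ range (a j), (MvPolynomial.X i - MvPolynomial.C (q ^ t * q) * MvPolynomial.X j)

/-- The exponent vector of the monomial by which the `q`-Dyson product has to be multiplied to
become a polynomial. -/
noncomputable def dysonExp {m : ℕ} (a : Fin m → ℕ) : Fin m →₀ ℕ :=
  Finsupp.equivFunOnFinite.symm fun i => ∑ j ∈ {i}ᶜ, a j

theorem dysonExp_apply {m : ℕ} (a : Fin m → ℕ) (i : Fin m) : dysonExp a i = ∑ j ∈ {i}ᶜ, a j :=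
  rfl

theorem dysonExp_add {m : ℕ} (a : Fin m → ℕ) (i : Fin m) : dysonExp a i + a i = ∑ j, a j := by
  rw [dysonExp_apply, Fintype.sum_eq_sum_compl_add i]

/-- Each `x i` collects `a j` from every pair containing `i`. With `x = 1` this bounds the degree;
with unit vectors it gives the clearing monomial. -/
theorem sum_Ioi_eq_sum_dysonExp {m : ℕ} {M : Type*} [AddCommMonoid M] (a : Fin m → ℕ)
    (x : Fin m → M) :
    ∑ i, ∑ j ∈ Ioi i, (a i • x j + a j • x i) = ∑ i, dysonExp a i • x i := by
  simp only [dysonExp_apply, sum_smul]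
  rw [← sum_sum_Ioi_add_eq_sum_sum_off_diag fun j i => a j • x i]
  simp only [add_comm]

theorem totalDegree_dysonPoly_le {m : ℕ} (a : Fin m → ℕ) :
    (dysonPoly a).totalDegree ≤ ∑ i, dysonExp a i := by
  have hlin : ∀ (i j : Fin m) (c : K),
      (MvPolynomial.X j - MvPolynomial.C c * MvPolynomial.X i).totalDegree ≤ 1 := by
    intro i j c
    refine (MvPolynomial.totalDegree_sub _ _).trans (max_le (MvPolynomial.totalDegree_X j).le ?_)
    refine (MvPolynomial.totalDegree_mul _ _).trans ?_
    rw [MvPolynomial.totalDegree_C, MvPolynomial.totalDegree_X]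
  have hprod : ∀ (i j : Fin m) (c : ℕ → K) (p : ℕ), (∏ t ∈ range p,
      (MvPolynomial.X j - MvPolynomial.C (c t) * MvPolynomial.X i)).totalDegree ≤ p := by
    intro i j c p
    refine (MvPolynomial.totalDegree_finsetProd _ _).trans ?_
    refine (sum_le_sum fun t _ => hlin i j (c t)).trans ?_
    simp
  have h := sum_Ioi_eq_sum_dysonExp a fun _ => (1 : ℕ)
  simp only [smul_eq_mul, mul_one] at h
  rw [← h, dysonPoly]
  refine (MvPolynomial.totalDegree_finsetProd _ _).trans (sum_le_sum fun i _ => ?_)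
  refine (MvPolynomial.totalDegree_finsetProd _ _).trans (sum_le_sum fun j _ => ?_)
  exact (MvPolynomial.totalDegree_mul _ _).trans (add_le_add (hprod _ _ _ _) (hprod _ _ _ _))

theorem dysonProd_natCast (a : Fin n → ℕ) (b : ℕ) :
    dysonProd a b = ∏ i : Fin (n + 1), ∏ j ∈ Ioi i,
      (qFac (ratio i j) ((Fin.cons b a : Fin (n + 1) → ℕ) i) *
        qFac (q • ratio j i) ((Fin.cons b a : Fin (n + 1) → ℕ) j) : Series n) := by
  rw [Fin.prod_univ_succ, Fin.prod_Ioi_zero]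
  simp only [Fin.prod_Ioi_succ, Fin.cons_zero, Fin.cons_succ]
  rfl

theorem dysonProd_mul_monomial (a : Fin n → ℕ) (b : ℕ) :
    dysonProd a b * monomial (fun i => (dysonExp (Fin.cons b a : Fin (n + 1) → ℕ) i : ℤ)) =
      toSeries (dysonPoly (Fin.cons b a : Fin (n + 1) → ℕ)) := by
  rw [dysonProd_natCast]
  generalize (Fin.cons b a : Fin (n + 1) → ℕ) = A
  have hexp : (fun i => (dysonExp A i : ℤ)) =
      ∑ i, ∑ j ∈ Ioi i, (A i • Pi.single j 1 + A j • Pi.single i 1) := by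
    rw [sum_Ioi_eq_sum_dysonExp A fun i : Fin (n + 1) => (Pi.single i 1 : Fin (n + 1) → ℤ)]
    funext i
    simp [Finset.sum_apply, Pi.single_apply]
  rw [hexp, dysonPoly, map_prod, monomial_sum, ← prod_mul_distrib]
  refine prod_congr rfl fun i _ => ?_
  rw [map_prod, monomial_sum, ← prod_mul_distrib]
  refine prod_congr rfl fun j _ => ?_
  rw [map_mul, monomial_add, mul_mul_mul_comm, qFac_smul_ratio_mul_monomial q j i (A j)]
  have := qFac_smul_ratio_mul_monomial (n := n) 1 i j (A i)
  simp only [one_smul, mul_one] at this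
  rw [this]

theorem Q_natCast_eq_coeff (a : Fin n → ℕ) (b : ℕ) :
    Q a b = (dysonPoly (Fin.cons b a : Fin (n + 1) → ℕ)).coeff (dysonExp (Fin.cons b a)) := by
  rw [← constTerm_monomial_neg_mul_toSeries, ← dysonProd_mul_monomial, mul_left_comm,
    ← monomial_add, neg_add_cancel, monomial_zero, mul_one, Q]

theorem eval_dysonPoly {m : ℕ} (a : Fin m → ℕ) (x : Fin m → K) :
    MvPolynomial.eval x (dysonPoly a) = ∏ i, ∏ j ∈ Ioi i,
      (∏ t ∈ range (a i), (x j - q ^ t * x i)) * ∏ t ∈ range (a j), (x i - q ^ t * q * x j) := by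
  simp [dysonPoly, map_prod]

/-- For `i < j`, a factor vanishes when `0 ≤ c j - c i < a i` or `1 ≤ c i - c j ≤ a j`. Otherwise
the intervals `[c i, c i + a i)` are separated, with a gap at inversions because of the extra `q`,
and the grid bound makes them fit into `[0, ∑ a)`. -/
theorem eq_sum_Iio_of_eval_dysonPoly_ne_zero {m : ℕ} {a : Fin (m + 1) → ℕ} {c : Fin (m + 1) → ℕ}
    (hc : ∀ i, c i ≤ dysonExp a i)
    (h : MvPolynomial.eval (fun i => q ^ c i) (dysonPoly a) ≠ 0) (i : Fin (m + 1)) :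
    c i = ∑ j ∈ Iio i, a j := by
  have hne : ∀ i j, i < j → (∀ t < a i, q ^ c j - q ^ t * q ^ c i ≠ 0) ∧
      ∀ t < a j, q ^ c i - q ^ t * q * q ^ c j ≠ 0 := by
    intro i j hij
    rw [eval_dysonPoly] at h
    have := prod_ne_zero_iff.1 (prod_ne_zero_iff.1 h i (mem_univ i)) j (mem_Ioi.2 hij)
    rw [mul_ne_zero_iff, prod_ne_zero_iff, prod_ne_zero_iff] at this
    simpa only [mem_range] using this
  refine eq_sum_Iio_of_separated (fun i => ?_) (fun i j hij hle => ?_) (fun i j hij hlt => ?_) i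
  · have := dysonExp_add a i
    have := hc i
    omega
  · by_contra! hcon
    refine (hne i j hij).1 (c j - c i) (by omega) ?_
    rw [← pow_add, Nat.sub_add_cancel hle, sub_self]
  · by_contra! hcon
    refine (hne i j hij).2 (c i - c j - 1) (by omega) ?_
    rw [← pow_succ, ← pow_add, show c i - c j - 1 + 1 + c j = c i by omega, sub_self]

theorem coeff_dysonPoly {m : ℕ} (a : Fin (m + 1) → ℕ) :
    (dysonPoly a).coeff (dysonExp a) =
      (∏ i, ∏ j ∈ Ioi i,
        (∏ t ∈ range (a i), (q ^ (∑ k ∈ Iio j, a k) - q ^ t * q ^ (∑ k ∈ Iio i, a k))) *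
          ∏ t ∈ range (a j), (q ^ (∑ k ∈ Iio i, a k) - q ^ t * q * q ^ (∑ k ∈ Iio j, a k))) *
      ∏ i, (∏ t ∈ (range (dysonExp a i + 1)).erase (∑ k ∈ Iio i, a k),
        (q ^ (∑ k ∈ Iio i, a k) - q ^ t))⁻¹ := by
  rw [coeff_eq_sum_piFinset (totalDegree_dysonPoly_le a) q_pow_injective,
    sum_eq_single fun i => ∑ k ∈ Iio i, a k]
  · rw [eval_dysonPoly]
  · intro c hc hne
    rw [mul_eq_zero]
    left
    by_contra h
    refine hne (funext fun i => eq_sum_Iio_of_eval_dysonPoly_ne_zero (fun i => ?_) h i)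
    exact Nat.lt_succ_iff.1 (mem_range.1 (Fintype.mem_piFinset.1 hc i))
  · intro h
    refine absurd (Fintype.mem_piFinset.2 fun i => mem_range.2 ?_) h
    have := dysonExp_add a i
    have := sum_Iio_add_le a i
    omega

/-! ### Polynomial dependence on `z = q ^ b` -/

theorem one_sub_q_pow_ne_zero (k : ℕ) : 1 - q ^ (k + 1) ≠ 0 := by
  rw [← pow_zero q]
  exact sub_ne_zero.2 (q_pow_injective.ne (Nat.succ_ne_zero k).symm)

/-- The polynomial in `z` whose value at `z = q ^ b` is the coefficient of `w ^ k` in the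
`q`-shifted factorial `(w)_b`. -/
noncomputable def qFacCoeff (k : ℕ) : Polynomial K :=
  ∏ i ∈ range k, (Polynomial.X - Polynomial.C (q ^ i)) * Polynomial.C (1 - q ^ (i + 1))⁻¹

theorem eval_qFacCoeff_succ (k : ℕ) (z : K) :
    (qFacCoeff (k + 1)).eval z = (qFacCoeff k).eval z * ((z - q ^ k) * (1 - q ^ (k + 1))⁻¹) := by
  simp [qFacCoeff, prod_range_succ]

theorem eval_qFacCoeff_zero (z : K) : (qFacCoeff 0).eval z = 1 := by
  simp [qFacCoeff]

theorem eval_one_qFacCoeff_succ (k : ℕ) : (qFacCoeff (k + 1)).eval 1 = 0 := by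
  induction k with
  | zero => simp [eval_qFacCoeff_succ]
  | succ k ih => rw [eval_qFacCoeff_succ, ih, zero_mul]

/-- This is `(w)_{b+1} = (w)_b (1 - w q^b)` read off at `w ^ (k + 1)`, with `z` in place of `q ^ b`.
-/
theorem eval_qFacCoeff_succ_mul (k : ℕ) (z : K) :
    (qFacCoeff (k + 1)).eval (z * q) =
      (qFacCoeff (k + 1)).eval z - z * (qFacCoeff k).eval z := by
  induction k with
  | zero =>
    have := one_sub_q_pow_ne_zero 0
    simp only [eval_qFacCoeff_succ, eval_qFacCoeff_zero]
    field_simp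
    ring
  | succ k ih =>
    have h₁ := one_sub_q_pow_ne_zero k
    have h₂ := one_sub_q_pow_ne_zero (k + 1)
    rw [eval_qFacCoeff_succ (k + 1), ih, eval_qFacCoeff_succ (k + 1), eval_qFacCoeff_succ k]
    field_simp
    ring

/-- The power series `(w)_b` in `x₀`, where `w` is `x₀` times the monomial with exponent `e`. -/
noncomputable def qFacSeries (e : Fin n → ℤ) (b : ℤ) : PowerSeries (LaurentPoly n) :=
  PowerSeries.mk fun k => AddMonoidAlgebra.single (k • e) ((qFacCoeff k).eval (q ^ b))

theorem qFacSeries_zero (e : Fin n → ℤ) : qFacSeries e 0 = 1 := by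
  refine PowerSeries.ext fun k => ?_
  cases k with
  | zero =>
    simp [qFacSeries, eval_qFacCoeff_zero, AddMonoidAlgebra.one_def]
  | succ k => simp [qFacSeries, eval_one_qFacCoeff_succ, PowerSeries.coeff_one]

theorem qFacSeries_add_one (e : Fin n → ℤ) (b : ℤ) :
    qFacSeries e (b + 1) = qFacSeries e b *
      (1 - PowerSeries.C (AddMonoidAlgebra.single e (q ^ b)) * PowerSeries.X) := by
  refine PowerSeries.ext fun k => ?_
  rw [mul_sub, mul_one, map_sub, mul_left_comm]
  rw [PowerSeries.coeff_C_mul]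
  cases k with
  | zero => simp [qFacSeries, eval_qFacCoeff_zero]
  | succ k =>
    rw [PowerSeries.coeff_succ_mul_X, qFacSeries, qFacSeries, PowerSeries.coeff_mk,
      PowerSeries.coeff_mk, PowerSeries.coeff_mk, AddMonoidAlgebra.single_mul_single,
      zpow_add_one₀ q_ne_zero, eval_qFacCoeff_succ_mul, ← succ_nsmul', AddMonoidAlgebra.single_sub]

theorem smul_ratio_zero_succ (c : K) (j : Fin n) :
    c • (ratio 0 j.succ : Series n) = HahnSeries.ofPowerSeries ℤ (LaurentPoly n)
      (PowerSeries.C (AddMonoidAlgebra.single (-Pi.single j 1) c) * PowerSeries.X) := by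
  have h0 : (Pi.single 0 1 - Pi.single j.succ 1 : Fin (n + 1) → ℤ) 0 = 1 := by simp
  have hs : (fun k : Fin n => (Pi.single 0 1 - Pi.single j.succ 1 : Fin (n + 1) → ℤ) k.succ) =
      -Pi.single j 1 := by
    funext k
    simp [Pi.single_apply]
  rw [map_mul, HahnSeries.ofPowerSeries_C, HahnSeries.ofPowerSeries_X, ratio, monomial, h0, hs,
    HahnSeries.C_mul_eq_smul]
  refine HahnSeries.ext (funext fun k => ?_)
  rw [HahnSeries.coeff_smul, HahnSeries.coeff_smul]
  by_cases hk : k = 1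
  · subst hk
    simp
  · simp [HahnSeries.coeff_single_of_ne hk]

/-- The `q`-binomial theorem for all integers `b`: both sides obey the same recurrence in `b` and
equal `1` at `b = 0`. -/
theorem qFac_ratio_zero_succ (j : Fin n) (b : ℤ) :
    qFac (ratio 0 j.succ : Series n) b =
      HahnSeries.ofPowerSeries ℤ (LaurentPoly n) (qFacSeries (-Pi.single j 1) b) := by
  have hstep : ∀ b : ℤ, HahnSeries.ofPowerSeries ℤ (LaurentPoly n)
        (qFacSeries (-Pi.single j 1) (b + 1)) =
      HahnSeries.ofPowerSeries ℤ (LaurentPoly n) (qFacSeries (-Pi.single j 1) b) *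
        (1 - q ^ b • ratio 0 j.succ) := fun b => by
    rw [smul_ratio_zero_succ, qFacSeries_add_one, map_mul, map_sub, map_one]
  cases b with
  | ofNat p =>
    rw [qFac]
    induction p with
    | zero => simp [qFacSeries_zero]
    | succ p ih =>
      rw [prod_range_succ, ih, Int.ofNat_eq_natCast, Int.ofNat_eq_natCast, Nat.cast_succ, hstep,
        zpow_natCast]
  | negSucc p =>
    -- Running the recurrence downwards shows that the series inverts the denominator, with no
    -- division.
    have key : ∀ p : ℕ, HahnSeries.ofPowerSeries ℤ (LaurentPoly n)
        (qFacSeries (-Pi.single j 1) (-(p : ℤ))) *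
          ∏ m ∈ range p, (1 - (q⁻¹) ^ (m + 1) • (ratio 0 j.succ : Series n)) = 1 := by
      intro p
      induction p with
      | zero => simp [qFacSeries_zero]
      | succ p ih =>
        have := hstep (-((p + 1 : ℕ) : ℤ))
        rw [zpow_neg, zpow_natCast, ← inv_pow,
          show -((p + 1 : ℕ) : ℤ) + 1 = -(p : ℤ) by push_cast; ring] at this
        rw [prod_range_succ, mul_comm (∏ m ∈ range p, _), ← mul_assoc, ← this, ih]
    rw [qFac, show Int.negSucc p = -((p + 1 : ℕ) : ℤ) from rfl]
    have hD := Ring.mul_inverse_cancel _ (isUnit_denominator j (p + 1))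
    have hS := key (p + 1)
    generalize (∏ m ∈ range (p + 1), (1 - (q⁻¹) ^ (m + 1) • (ratio 0 j.succ : Series n))) = D
      at hD hS ⊢
    rw [← one_mul (Ring.inverse D), ← hS, mul_assoc, hD, mul_one]

/-- Evaluation of the coefficients of a power series over the Laurent polynomials. -/
noncomputable def evalSeries (z : K) :
    PowerSeries (AddMonoidAlgebra (Polynomial K) (Fin n → ℤ)) →+* PowerSeries (LaurentPoly n) :=
  PowerSeries.map (AddMonoidAlgebra.mapRingHom _ (Polynomial.evalRingHom z))

theorem evalSeries_map_C (z : K) (f : PowerSeries (LaurentPoly n)) :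
    evalSeries z (PowerSeries.map (AddMonoidAlgebra.mapRingHom _ Polynomial.C) f) = f := by
  refine PowerSeries.ext fun k => AddMonoidAlgebra.ext (Finsupp.ext fun e => ?_)
  simp [evalSeries]

theorem evalSeries_mk_qFacCoeff (e : Fin n → ℤ) (b : ℤ) :
    evalSeries (q ^ b) (PowerSeries.mk fun k => AddMonoidAlgebra.single (k • e) (qFacCoeff k)) =
      qFacSeries e b := by
  refine PowerSeries.ext fun k => ?_
  simp [evalSeries, qFacSeries]

/-- Only the factors `(x₀/xⱼ)_b` involve `b`, and their coefficients are polynomials in `z`. The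
remaining factor `M` has a lowest power of `x₀`, so the constant term is one coefficient of a power
series `G` over Laurent polynomials with coefficients in `K[z]`. -/
theorem exists_polynomial_eval_eq_Q (a : Fin n → ℕ) :
    ∃ P : Polynomial K, ∀ b : ℤ, Q a b = P.eval (q ^ b) := by
  set M : Series n := (∏ j : Fin n, qFac (q • ratio j.succ 0) (a j)) *
    ∏ i : Fin n, ∏ j ∈ Ioi i,
      qFac (ratio i.succ j.succ) (a i) * qFac (q • ratio j.succ i.succ) (a j) with hM
  set G : PowerSeries (AddMonoidAlgebra (Polynomial K) (Fin n → ℤ)) :=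
    (∏ j : Fin n, PowerSeries.mk fun k =>
      AddMonoidAlgebra.single (k • (-Pi.single j 1 : Fin n → ℤ)) (qFacCoeff k)) *
      PowerSeries.map (AddMonoidAlgebra.mapRingHom _ Polynomial.C) M.powerSeriesPart with hG
  have hprod : ∀ b : ℤ, dysonProd a b = HahnSeries.single M.order 1 *
      HahnSeries.ofPowerSeries ℤ (LaurentPoly n) (evalSeries (q ^ b) G) := by
    intro b
    rw [hG, map_mul, evalSeries_map_C, map_prod, map_mul, map_prod, mul_left_comm,
      LaurentSeries.single_order_mul_powerSeriesPart, dysonProd, prod_mul_distrib, mul_assoc,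
      ← hM]
    congr 1
    exact prod_congr rfl fun j _ => by rw [evalSeries_mk_qFacCoeff, qFac_ratio_zero_succ]
  -- If `M` starts at a positive power of `x₀`, nothing reaches `x₀⁰`.
  refine ⟨if -M.order < 0 then 0 else (PowerSeries.coeff (-M.order).natAbs G).coeff 0,
    fun b => ?_⟩
  rw [Q, hprod, constTerm]
  have h := HahnSeries.coeff_single_mul_add (r := (1 : LaurentPoly n)) (a := -M.order)
    (b := M.order)
    (x := HahnSeries.ofPowerSeries ℤ (LaurentPoly n) (evalSeries (q ^ b) G))
  rw [neg_add_cancel] at h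
  rw [h, one_mul, PowerSeries.coeff_coe]
  split_ifs
  · simp
  · simp [evalSeries]

/-! ### The product formula as an identity in `z`, and its zeros -/

theorem sum_Iio_cons_succ (a : Fin n → ℕ) (b : ℕ) (j : Fin n) :
    ∑ k ∈ Iio j.succ, (Fin.cons b a : Fin (n + 1) → ℕ) k = b + ∑ k ∈ Iio j, a k := by
  have : Iio j.succ = insert 0 ((Iio j).map (Fin.succEmb n)) := by
    ext k
    refine Fin.cases ?_ (fun k => ?_) k
    · simp
    · simp
  rw [this, sum_insert (by simp), sum_map]
  rfl

theorem dysonExp_cons_zero (a : Fin n → ℕ) (b : ℕ) :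
    dysonExp (Fin.cons b a : Fin (n + 1) → ℕ) 0 = ∑ j, a j := by
  have := dysonExp_add (Fin.cons b a : Fin (n + 1) → ℕ) 0
  rw [Fin.sum_univ_succ] at this
  simp only [Fin.cons_zero, Fin.cons_succ] at this
  omega

theorem dysonExp_cons_succ (a : Fin n → ℕ) (b : ℕ) (j : Fin n) :
    dysonExp (Fin.cons b a : Fin (n + 1) → ℕ) j.succ = b + dysonExp a j := by
  have h₁ := dysonExp_add (Fin.cons b a : Fin (n + 1) → ℕ) j.succ
  have h₂ := dysonExp_add a j
  rw [Fin.sum_univ_succ] at h₁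
  simp only [Fin.cons_zero, Fin.cons_succ] at h₁
  omega

theorem prod_erase_range_add {M : Type*} [CommMonoid M] (f : ℕ → M) {b s e : ℕ} :
    ∏ t ∈ (range (b + e)).erase (b + s), f t =
      (∏ t ∈ range b, f t) * ∏ t ∈ (range e).erase s, f (b + t) := by
  have : (range (b + e)).erase (b + s) =
      (range b).disjUnion (((range e).erase s).map (addLeftEmbedding b)) (by
        rw [disjoint_left]
        intro t ht
        simp only [mem_map, addLeftEmbedding_apply, not_exists, mem_range] at ht ⊢
        omega) := by
    ext t
    simp only [mem_erase, mem_range, mem_disjUnion, mem_map, addLeftEmbedding_apply]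
    constructor
    · intro h
      by_cases ht : t < b
      · exact Or.inl ht
      · exact Or.inr ⟨t - b, by omega⟩
    · rintro (h | ⟨x, h⟩) <;> omega
  rw [this, prod_disjUnion, prod_map]
  rfl

/-- The part of the `q`-Dyson constant term that does not involve `x₀`, as a polynomial in
`z = q ^ b`. -/
noncomputable def restNum (a : Fin n → ℕ) : Polynomial K :=
  ∏ i, ∏ j ∈ Ioi i,
    (∏ t ∈ range (a i), Polynomial.X *
      Polynomial.C (q ^ (∑ k ∈ Iio j, a k) - q ^ t * q ^ (∑ k ∈ Iio i, a k))) *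
    ∏ t ∈ range (a j), Polynomial.X *
      Polynomial.C (q ^ (∑ k ∈ Iio i, a k) - q ^ t * q * q ^ (∑ k ∈ Iio j, a k))

/-- The factors of the `q`-Dyson constant term that vanish at `z = q ^ (-1), q ^ (-2), …`. -/
noncomputable def vanishingNum (a : Fin n → ℕ) : Polynomial K :=
  ∏ j, ∏ t ∈ range (a j),
    (1 - Polynomial.C (q ^ t * q * q ^ (∑ k ∈ Iio j, a k)) * Polynomial.X)

/-- The denominator of the `q`-Dyson constant term, as a polynomial in `z = q ^ b`. -/
noncomputable def den (a : Fin n → ℕ) : Polynomial K :=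
  Polynomial.C (∏ t ∈ (range (∑ j, a j + 1)).erase 0, (1 - q ^ t)) *
    ∏ j, ∏ t ∈ (range (dysonExp a j + 1)).erase (∑ k ∈ Iio j, a k),
      Polynomial.X * Polynomial.C (q ^ (∑ k ∈ Iio j, a k) - q ^ t)

theorem q_pow_sub_q_pow_ne_zero {s t : ℕ} (h : t ≠ s) : q ^ s - q ^ t ≠ 0 :=
  sub_ne_zero.2 (q_pow_injective.ne h.symm)

theorem eval_den_ne_zero (a : Fin n → ℕ) {z : K} (hz : z ≠ 0) : (den a).eval z ≠ 0 := by
  rw [den, Polynomial.eval_mul, Polynomial.eval_C, Polynomial.eval_prod]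
  refine mul_ne_zero (prod_ne_zero_iff.2 fun t ht => ?_) (prod_ne_zero_iff.2 fun j _ => ?_)
  · rw [← pow_zero q]
    exact q_pow_sub_q_pow_ne_zero (ne_of_mem_erase ht)
  · rw [Polynomial.eval_prod]
    refine prod_ne_zero_iff.2 fun t ht => ?_
    rw [Polynomial.eval_mul, Polynomial.eval_X, Polynomial.eval_C]
    exact mul_ne_zero hz (q_pow_sub_q_pow_ne_zero (ne_of_mem_erase ht))

/-- The factors whose number grows with `b` form the same product `G` above and below: above from
the pairs `(0, j)`, below from the nodes `q ^ t` with `t < b`. After cancelling `G`, the number of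
factors is independent of `b`. -/
theorem Q_natCast_mul_eval_den (a : Fin n → ℕ) (b : ℕ) :
    Q a b * (den a).eval (q ^ b) = (vanishingNum a * restNum a).eval (q ^ b) := by
  set G : K := ∏ j : Fin n, ∏ t ∈ range b, (q ^ (b + ∑ k ∈ Iio j, a k) - q ^ t) with hG
  have hG0 : G ≠ 0 := prod_ne_zero_iff.2 fun j _ => prod_ne_zero_iff.2 fun t ht =>
    q_pow_sub_q_pow_ne_zero (by have := mem_range.1 ht; omega)
  have hnum : (∏ i : Fin (n + 1), ∏ j ∈ Ioi i,
      (∏ t ∈ range ((Fin.cons b a : Fin (n + 1) → ℕ) i),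
        (q ^ (∑ k ∈ Iio j, (Fin.cons b a : Fin (n + 1) → ℕ) k) -
          q ^ t * q ^ (∑ k ∈ Iio i, (Fin.cons b a : Fin (n + 1) → ℕ) k))) *
      ∏ t ∈ range ((Fin.cons b a : Fin (n + 1) → ℕ) j),
        (q ^ (∑ k ∈ Iio i, (Fin.cons b a : Fin (n + 1) → ℕ) k) -
          q ^ t * q * q ^ (∑ k ∈ Iio j, (Fin.cons b a : Fin (n + 1) → ℕ) k))) =
      G * (vanishingNum a * restNum a).eval (q ^ b) := by
    rw [Fin.prod_univ_succ, Fin.prod_Ioi_zero]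
    simp only [Fin.prod_Ioi_succ, Fin.cons_zero, Fin.cons_succ, sum_Iio_cons_succ, sum_Iio_zero,
      pow_zero, mul_one, Polynomial.eval_mul, vanishingNum, restNum, Polynomial.eval_prod,
      Polynomial.eval_sub, Polynomial.eval_one, Polynomial.eval_C, Polynomial.eval_X]
    rw [prod_mul_distrib, ← hG, ← mul_assoc]
    congr 1
    · congr 1
      refine prod_congr rfl fun j _ => prod_congr rfl fun t _ => ?_
      ring
    · refine prod_congr rfl fun i _ => prod_congr rfl fun j _ => ?_
      congr 1 <;> refine prod_congr rfl fun t _ => by ring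
  have hden : (∏ i : Fin (n + 1),
      (∏ t ∈ (range (dysonExp (Fin.cons b a : Fin (n + 1) → ℕ) i + 1)).erase
          (∑ k ∈ Iio i, (Fin.cons b a : Fin (n + 1) → ℕ) k),
        (q ^ (∑ k ∈ Iio i, (Fin.cons b a : Fin (n + 1) → ℕ) k) - q ^ t))⁻¹) =
      (G * (den a).eval (q ^ b))⁻¹ := by
    rw [prod_inv_distrib, Fin.prod_univ_succ]
    congr 1
    simp only [sum_Iio_cons_succ, sum_Iio_zero, dysonExp_cons_zero, dysonExp_cons_succ, add_assoc,
      prod_erase_range_add, prod_mul_distrib, pow_zero, den, Polynomial.eval_mul,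
      Polynomial.eval_prod, Polynomial.eval_C, Polynomial.eval_X, ← hG]
    rw [mul_left_comm]
    congr 2
    rw [← prod_mul_distrib]
    refine prod_congr rfl fun j _ => ?_
    rw [← prod_mul_distrib]
    exact prod_congr rfl fun t _ => by ring
  have hz : (den a).eval (q ^ b) ≠ 0 := eval_den_ne_zero a (pow_ne_zero b q_ne_zero)
  rw [Q_natCast_eq_coeff, coeff_dysonPoly, hnum, hden]
  field_simp

/-- The root exponents coming from index `j` fill a block of length `a j`, and the consecutive
blocks exhaust `-1, …, -a`. -/
theorem eval_vanishingNum (a : Fin n → ℕ) {m : ℕ} (hm : m < ∑ j, a j) :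
    (vanishingNum a).eval (q ^ (-((m + 1 : ℕ) : ℤ))) = 0 := by
  obtain ⟨j, t, ht, rfl⟩ := exists_eq_sum_Iio_add a hm
  rw [vanishingNum, Polynomial.eval_prod]
  refine prod_eq_zero (mem_univ j) ?_
  rw [Polynomial.eval_prod]
  refine prod_eq_zero (mem_range.2 ht) ?_
  rw [Polynomial.eval_sub, Polynomial.eval_one, Polynomial.eval_mul, Polynomial.eval_C,
    Polynomial.eval_X, ← pow_succ, ← pow_add, zpow_neg, zpow_natCast,
    show t + 1 + ∑ k ∈ Iio j, a k = ∑ k ∈ Iio j, a k + t + 1 by omega,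
    mul_inv_cancel₀ (pow_ne_zero _ q_ne_zero), sub_self]

end QDyson

theorem lemma4 (n : ℕ) (a : Fin n → ℕ) (b : ℤ)
    (hb : -(∑ j, (a j : ℤ)) ≤ b) (hb' : b ≤ -1) :
    QDyson.Q a b = 0 := by
  obtain ⟨P, hP⟩ := QDyson.exists_polynomial_eval_eq_Q a
  have hpoly : P * QDyson.den a = QDyson.vanishingNum a * QDyson.restNum a := by
    -- The two sides agree at every `q ^ k` with `k` natural, and these points are pairwise
    -- distinct.
    refine Polynomial.eq_of_infinite_eval_eq _ _
      ((Set.infinite_range_of_injective QDyson.q_pow_injective).mono ?_)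
    rintro _ ⟨k, rfl⟩
    have := QDyson.Q_natCast_mul_eval_den a k
    rw [hP, zpow_natCast] at this
    rwa [Set.mem_ofPred_eq, Polynomial.eval_mul]
  obtain ⟨m, rfl⟩ : ∃ m : ℕ, b = -((m + 1 : ℕ) : ℤ) := ⟨(-b - 1).toNat, by omega⟩
  have hm : m < ∑ j, a j := by
    rw [← Nat.cast_sum] at hb
    omega
  have h := congrArg (Polynomial.eval (QDyson.q ^ (-((m + 1 : ℕ) : ℤ)))) hpoly
  rw [Polynomial.eval_mul, Polynomial.eval_mul, QDyson.eval_vanishingNum a hm, zero_mul,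
    ← hP] at h
  exact (mul_eq_zero.1 h).resolve_right
    (QDyson.eval_den_ne_zero a (zpow_ne_zero _ QDyson.q_ne_zero))
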